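/- Let $m\ge 2$, and let $\mathcal T$ be the $m$-adic rooted tree, whose vertices are the finite words over $\{1,\dots,m\}$. For $g\in\mathrm{Aut}\,\mathcal T$ and a vertex $v$, the section $g|_v$ is the automorphism with $(vu)g=(v)g\cdot(u)g|_v$ for all words $u$. Let $\mathrm{St}(n)$ be the subgroup of all automorphisms fixing every word of length $n$, and write $\psi(g)=(g|_1,\dots,g|_m)\pi$, where $\pi\in\mathrm{Sym}(m)$ is the action of $g$ on the first level (so $\psi(g)=(g|_1,\dots,g|_m)$ for $g\in\mathrm{St}(1)$). Let $\sigma=(1\,2\,\cdots\,m)$, and let $H=\langle a,b\rangle\le\mathrm{Aut}\,\mathcal T$ be the generalized Brunner–Sidki–Vieira group, where $a,b$ are defined recursively by $$\psi(a)=(1,\dots,1,a)\sigma,\qquad \psi(b)=(1,\dots,1,b^{-1})\sigma .$$ Let $H'=[H,H]$ be its commutator subgroup, $\mathrm{St}_{H'}(n)=\mathrm{St}(n)\cap H'$, and $L_2=\psi^{-1}(H'\times\overset{m}{\cdots}\times H')\le\mathrm{St}(1)$. Put $k_n=\lfloor n/2\rfloor$, $e_n=n-2k_n$, and let $\tau=0$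 if $m$ is odd and $\tau=1$ if $m$ is even. Then for every $n\ge 2$, $L_2\,\mathrm{St}_{H'}(n)$ is a subgroup of $H'$ of finite index, and $$\log_m|H':L_2\,\mathrm{St}_{H'}(n)|=(m-1)\bigl(k_n-e_{n-1}\,\tau\,\log_m 2\bigr).$$ -/

import Mathlib

namespace BSV

/-- The `m`-adic tree: vertices are the finite words over an alphabet of `m` letters (the letters
`1, …, m` are `0, …, m - 1` here), and `u`, `v` are joined when one of them is obtained from the
other by appending one letter. -/
def tree (m : ℕ) : SimpleGraph (List (Fin m)) where
  Adj u v := (∃ x, u = v ++ [x]) ∨ (∃ x, v = u ++ [x])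
  symm := ⟨fun _ _ h => h.symm⟩
  loopless := ⟨fun u h => by
    rcases h with ⟨x, h⟩ | ⟨x, h⟩ <;>
    · have := congrArg List.length h
      simp at this⟩

/-- The group `Aut T` of all graph automorphisms of the `m`-adic tree. The product is composition
of maps, `(f * g) v = f (g v)`. -/
abbrev AutT (m : ℕ) : Type := tree m ≃g tree m

/-- `h` is the section of `g` at the vertex `v`: `g (v u) = g v · h u` for all words `u`.
Such an `h` is unique. -/
def IsSection {m : ℕ} (g : AutT m) (v : List (Fin m)) (h : AutT m) : Prop :=
  ∀ u : List (Fin m), g (v ++ u) = g v ++ h u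

theorem IsSection.unique {m : ℕ} {g : AutT m} {v : List (Fin m)} {h h' : AutT m}
    (H : IsSection g v h) (H' : IsSection g v h') : h = h' := by
  apply RelIso.ext
  intro u
  exact List.append_cancel_left ((H u).symm.trans (H' u))

/-- The level stabilizer `St(n)`: the automorphisms fixing the `n`th level pointwise. -/
def St (m n : ℕ) : Subgroup (AutT m) where
  carrier := {g | ∀ v : List (Fin m), v.length = n → g v = v}
  one_mem' := fun _ _ => rfl
  mul_mem' := fun {f g} hf hg v hv => by
    rw [RelIso.mul_apply, hg v hv, hf v hv]
  inv_mem' := fun {g} hg v hv => by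
    have h := hg v hv
    calc g⁻¹ v = g⁻¹ (g v) := by rw [h]
      _ = v := RelIso.inv_apply_self g v

/-- For a subgroup `K` of `Aut T`, the subgroup `ψ⁻¹(K × ⋯ × K)` with `m` factors: the elements of
`St(1)` all of whose first level sections lie in `K`. -/
def psiInv {m : ℕ} (K : Subgroup (AutT m)) : Subgroup (AutT m) where
  carrier := {g | g ∈ St m 1 ∧ ∀ x : Fin m, ∃ h ∈ K, IsSection g [x] h}
  one_mem' := ⟨one_mem _, fun _ => ⟨1, one_mem _, fun _ => rfl⟩⟩
  mul_mem' := fun {f g} hf hg => ⟨mul_mem hf.1 hg.1, fun x => by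
    obtain ⟨p, hp, hps⟩ := hf.2 x
    obtain ⟨q, hq, hqs⟩ := hg.2 x
    refine ⟨p * q, mul_mem hp hq, fun u => ?_⟩
    simp only [RelIso.mul_apply]
    rw [hqs u, hg.1 [x] rfl, hps]⟩
  inv_mem' := fun {g} hg => ⟨inv_mem hg.1, fun x => by
    obtain ⟨p, hp, hps⟩ := hg.2 x
    refine ⟨p⁻¹, inv_mem hp, fun u => ?_⟩
    have h1 : g⁻¹ [x] = [x] := (inv_mem hg.1 : g⁻¹ ∈ St m 1) [x] rfl
    have h2 : g ([x] ++ p⁻¹ u) = [x] ++ u := by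
      rw [hps, hg.1 [x] rfl, RelIso.apply_inv_self]
    rw [h1, ← h2, RelIso.inv_apply_self]⟩

/-- A tree automorphism from a pair of mutually inverse maps on words, each of which sends a word
extended by one letter to the image of the word extended by one letter. -/
def mkAut {m : ℕ} (f g : List (Fin m) → List (Fin m))
    (hgf : ∀ u, g (f u) = u) (hfg : ∀ u, f (g u) = u)
    (hf : ∀ u x, ∃ y, f (u ++ [x]) = f u ++ [y])
    (hg : ∀ u x, ∃ y, g (u ++ [x]) = g u ++ [y]) : AutT m where
  toFun := f
  invFun := g
  left_inv := hgf
  right_inv := hfg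
  map_rel_iff' := by
    intro u v
    constructor
    · rintro (⟨x, h⟩ | ⟨x, h⟩)
      · obtain ⟨y, hy⟩ := hg (f v) x
        exact Or.inl ⟨y, by
          have h' : f u = f v ++ [x] := h
          rw [← h', hgf, hgf] at hy
          exact hy⟩
      · obtain ⟨y, hy⟩ := hg (f u) x
        exact Or.inr ⟨y, by
          have h' : f v = f u ++ [x] := h
          rw [← h', hgf, hgf] at hy
          exact hy⟩
    · rintro (⟨x, rfl⟩ | ⟨x, rfl⟩)
      · exact Or.inl (hf v x)
      · exact Or.inr (hf u x)

/-- The map of the generator `a` on words: the cycle `σ = (1 2 ⋯ m)` is applied to the first letter,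
and `a` to the remaining word if the first letter is the last one of the alphabet. -/
def aFun {m : ℕ} : List (Fin m) → List (Fin m)
  | [] => []
  | x :: u => finRotate m x :: (if x.val + 1 = m then aFun u else u)

/-- The inverse map of `aFun`. -/
def aInvFun {m : ℕ} : List (Fin m) → List (Fin m)
  | [] => []
  | y :: u => (finRotate m).symm y ::
      (if ((finRotate m).symm y).val + 1 = m then aInvFun u else u)

/-- The map of the generator `b` on words (flag `true`), and the inverse map (flag `false`): `b`
applies `σ` to the first letter, and `b⁻¹` to the remaining word if the first letter is the last
one of the alphabet. -/
def bFun {m : ℕ} : Bool → List (Fin m) → List (Fin m)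
  | _, [] => []
  | true, x :: u => finRotate m x :: (if x.val + 1 = m then bFun false u else u)
  | false, y :: u => (finRotate m).symm y ::
      (if ((finRotate m).symm y).val + 1 = m then bFun true u else u)

theorem aInvFun_aFun {m : ℕ} (u : List (Fin m)) : aInvFun (aFun u) = u := by
  induction u with
  | nil => rfl
  | cons x u ih =>
    simp only [aFun, aInvFun, Equiv.symm_apply_apply]
    split_ifs <;> simp [ih]

theorem aFun_aInvFun {m : ℕ} (u : List (Fin m)) : aFun (aInvFun u) = u := by
  induction u with
  | nil => rfl
  | cons x u ih =>
    simp only [aFun, aInvFun, Equiv.apply_symm_apply]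
    split_ifs <;> simp [ih]

theorem bFun_bFun {m : ℕ} (u : List (Fin m)) (c : Bool) : bFun (!c) (bFun c u) = u := by
  induction u generalizing c with
  | nil => cases c <;> rfl
  | cons x u ih =>
    have h1 := ih true
    have h2 := ih false
    simp only [Bool.not_true, Bool.not_false] at h1 h2
    cases c <;> simp only [bFun, Bool.not_true, Bool.not_false, Equiv.symm_apply_apply,
      Equiv.apply_symm_apply] <;> split_ifs <;> simp [h1, h2]

theorem aFun_append {m : ℕ} (u : List (Fin m)) (x : Fin m) :
    ∃ y, aFun (u ++ [x]) = aFun u ++ [y] := by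
  induction u with
  | nil => exact ⟨finRotate m x, by simp [aFun]⟩
  | cons z u ih =>
    obtain ⟨y, hy⟩ := ih
    by_cases h : z.val + 1 = m
    · exact ⟨y, by simp [aFun, h, hy]⟩
    · exact ⟨x, by simp [aFun, h]⟩

theorem aInvFun_append {m : ℕ} (u : List (Fin m)) (x : Fin m) :
    ∃ y, aInvFun (u ++ [x]) = aInvFun u ++ [y] := by
  induction u with
  | nil => exact ⟨(finRotate m).symm x, by simp [aInvFun]⟩
  | cons z u ih =>
    obtain ⟨y, hy⟩ := ih
    by_cases h : ((finRotate m).symm z).val + 1 = m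
    · exact ⟨y, by simp only [aInvFun, List.cons_append, h, if_true, hy]⟩
    · exact ⟨x, by simp only [aInvFun, List.cons_append, h, if_false]⟩

theorem bFun_append {m : ℕ} (c : Bool) (u : List (Fin m)) (x : Fin m) :
    ∃ y, bFun c (u ++ [x]) = bFun c u ++ [y] := by
  induction u generalizing c with
  | nil =>
    cases c
    · exact ⟨(finRotate m).symm x, by simp [bFun]⟩
    · exact ⟨finRotate m x, by simp [bFun]⟩
  | cons z u ih =>
    cases c
    · obtain ⟨y, hy⟩ := ih true
      by_cases h : ((finRotate m).symm z).val + 1 = m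
      · exact ⟨y, by simp only [bFun, List.cons_append, h, if_true, hy]⟩
      · exact ⟨x, by simp only [bFun, List.cons_append, h, if_false]⟩
    · obtain ⟨y, hy⟩ := ih false
      by_cases h : z.val + 1 = m
      · exact ⟨y, by simp only [bFun, List.cons_append, h, if_true, hy]⟩
      · exact ⟨x, by simp only [bFun, List.cons_append, h, if_false]⟩

/-- The generator `a`, with `ψ(a) = (1, …, 1, a) σ`. -/
def a (m : ℕ) : AutT m :=
  mkAut aFun aInvFun aInvFun_aFun aFun_aInvFun aFun_append aInvFun_append

/-- The generator `b`, with `ψ(b) = (1, …, 1, b⁻¹) σ`. -/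
def b (m : ℕ) : AutT m :=
  mkAut (bFun true) (bFun false) (fun u => bFun_bFun u true) (fun u => bFun_bFun u false)
    (bFun_append true) (bFun_append false)

/-- The recursion `ψ(a) = (1, …, 1, a) σ`. -/
theorem a_recursion (m : ℕ) (x : Fin m) :
    a m [x] = [finRotate m x] ∧ IsSection (a m) [x] (if x.val + 1 = m then a m else 1) := by
  have h0 : a m [x] = [finRotate m x] := by
    change aFun [x] = _
    simp [aFun]
  refine ⟨h0, fun u => ?_⟩
  rw [h0]
  change aFun (x :: u) = _
  by_cases h : x.val + 1 = m
  · simp only [aFun, h, if_true]; rfl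
  · simp only [aFun, h, if_false]; rfl

/-- The recursion `ψ(b) = (1, …, 1, b⁻¹) σ`. -/
theorem b_recursion (m : ℕ) (x : Fin m) :
    b m [x] = [finRotate m x] ∧ IsSection (b m) [x] (if x.val + 1 = m then (b m)⁻¹ else 1) := by
  have h0 : b m [x] = [finRotate m x] := by
    change bFun true [x] = _
    simp [bFun]
  refine ⟨h0, fun u => ?_⟩
  rw [h0]
  change bFun true (x :: u) = _
  by_cases h : x.val + 1 = m
  · simp only [bFun, h, if_true]; rfl
  · simp only [bFun, h, if_false]; rfl

/-- The generalized Brunner–Sidki–Vieira group `H = ⟨a, b⟩`. -/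
def H (m : ℕ) : Subgroup (AutT m) := Subgroup.closure {a m, b m}

/-- The commutator subgroup `H'`, as a subgroup of `Aut T`. -/
def H' (m : ℕ) : Subgroup (AutT m) := ⁅H m, H m⁆

/-- `L₂ = ψ⁻¹(H' × ⋯ × H')`. -/
def L₂ (m : ℕ) : Subgroup (AutT m) := psiInv (H' m)

/-- `St_{H'}(n) = St(n) ∩ H'`. -/
def StH' (m n : ℕ) : Subgroup (AutT m) := St m n ⊓ H' m

/-- `τ` is `0` for `m` odd and `1` for `m` even. -/
def τ (m : ℕ) : ℕ := if Odd m then 0 else 1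

/-- `k_n = ⌊n / 2⌋`. -/
def k (n : ℕ) : ℕ := n / 2

/-- `e_n = n - 2 k_n` (no truncation occurs, as `2 k_n ≤ n`). -/
def e (n : ℕ) : ℕ := n - 2 * k n

end BSV

namespace BSV

variable {m : ℕ}

/-! Everything is read off from the exponent sums `(A, B)` of words in `a`, `b`. Both generators add
one to the first letter modulo `m`, and their nontrivial sections, `a` and `b⁻¹`, sit where a carry
occurs. Hence a section has exponents `(δ + t, t)`, with `δ` the net carry at its letter, and the
`t` sum to `-B` (`HasExp.sections`). Conversely, sections with a common `δ` and arbitrary `t` always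
come from an element of the group (`exists_hasExp_of_sections`), because `a ^ m` acts as `a` below
every letter and conjugates of `b⁻¹ * a` act as `b * a` below a single letter.

So the exponents occurring in `St(n)` satisfy a recursion in `n`, which is solved by divisibility
conditions on `B` and `A + B` (`stExp_odd_even`). These force the identity to have exponents `(0,
0)`, so exponents are well defined; `H'` consists of the elements with exponents `(0, 0)`.

For an element of `H'` the carries vanish: its sections have exponents `(t x, t x)` with `∑ t = 0`,
and `L₂` is the locus `t = 0`. Modulo `L₂` an element lies in `St(n)` exactly when each `(t x, t x)`
occurs in `St(n - 1)`, that is, when a certain `d` divides each `t x` (`stExp_diag_iff`,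
`mem_sup_iff`). The sum-zero condition leaves `m - 1` free coordinates, so the quotient is
`(ℤ/d)^(m-1)` (`relIndex_sup`). -/

theorem val_finRotate_of_add_one_lt {x : Fin m} (h : x.val + 1 < m) :
    (finRotate m x).val = x.val + 1 := by
  obtain _ | m := m
  · exact x.elim0
  · rw [coe_finRotate_of_ne_last]
    intro hx
    rw [hx, Fin.val_last] at h
    omega

theorem val_finRotate_of_add_one_eq {x : Fin m} (h : x.val + 1 = m) :
    (finRotate m x).val = 0 := by
  obtain _ | m := m
  · exact x.elim0
  · have : x = Fin.last m := Fin.ext (by simp; omega)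
    rw [this, finRotate_last]
    rfl

theorem a_cons (x : Fin m) (u : List (Fin m)) :
    a m (x :: u) = finRotate m x :: (if x.val + 1 = m then a m else 1) u := by
  have h := (a_recursion m x).2 u
  rwa [(a_recursion m x).1] at h

theorem b_cons (x : Fin m) (u : List (Fin m)) :
    b m (x :: u) = finRotate m x :: (if x.val + 1 = m then (b m)⁻¹ else 1) u := by
  have h := (b_recursion m x).2 u
  rwa [(b_recursion m x).1] at h

/-! ### Exponent sums and their behaviour under sections -/

/-- `g` is the value of a word in `a`, `b` whose exponent sums in `a` and `b` are `A` and `B`. -/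
inductive HasExp (m : ℕ) : AutT m → ℤ → ℤ → Prop
  | one : HasExp m 1 0 0
  | gen_a : HasExp m (a m) 1 0
  | gen_b : HasExp m (b m) 0 1
  | mul {f g : AutT m} {A B C D : ℤ} :
      HasExp m f A B → HasExp m g C D → HasExp m (f * g) (A + C) (B + D)
  | inv {g : AutT m} {A B : ℤ} : HasExp m g A B → HasExp m g⁻¹ (-A) (-B)

namespace HasExp

theorem cast {g : AutT m} {A B C D : ℤ} (h : HasExp m g A B) (h1 : A = C) (h2 : B = D) :
    HasExp m g C D := h1 ▸ h2 ▸ h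

theorem pow {g : AutT m} {A B : ℤ} (h : HasExp m g A B) (i : ℕ) :
    HasExp m (g ^ i) (i * A) (i * B) := by
  induction i with
  | zero => simpa using HasExp.one
  | succ i ih =>
    rw [pow_succ]
    exact (ih.mul h).cast (by push_cast; ring) (by push_cast; ring)

theorem zpow {g : AutT m} {A B : ℤ} (h : HasExp m g A B) (i : ℤ) :
    HasExp m (g ^ i) (i * A) (i * B) := by
  obtain ⟨i, rfl | rfl⟩ := i.eq_nat_or_neg
  · simpa using h.pow i
  · simpa using (h.pow i).inv

/-- Elements of `AutT m` are mere graph automorphisms; checking the generators avoids the valency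
argument for fixing the root. -/
theorem apply_nil {g : AutT m} {A B : ℤ} (h : HasExp m g A B) : g [] = [] := by
  induction h with
  | one => rfl
  | gen_a => rfl
  | gen_b => rfl
  | mul _ _ ih1 ih2 => rw [RelIso.mul_apply, ih2, ih1]
  | @inv g A B _ ih =>
    have := RelIso.inv_apply_self g []
    rwa [ih] at this

/-- The action on the first level and the exponent sums of the first level sections. -/
theorem sections {g : AutT m} {A B : ℤ} (hm : 0 < m) (h : HasExp m g A B) :
    ∃ (π : Equiv.Perm (Fin m)) (s : Fin m → AutT m) (δ t : Fin m → ℤ),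
      (∀ x u, g (x :: u) = π x :: s x u) ∧
      (∀ x, (x.val : ℤ) + (A + B) = (π x).val + m * δ x) ∧
      (∀ x, HasExp m (s x) (δ x + t x) (t x)) ∧ ∑ x, t x = -B := by
  -- The carry of a generator. In both sections at a carry, `a` and `b⁻¹`, the `a`-exponent minus
  -- the `b`-exponent is `1`.
  have hδ : ∀ x : Fin m, (x.val : ℤ) + 1 =
      (finRotate m x).val + m * (if x.val + 1 = m then 1 else 0) := by
    intro x
    split_ifs with hx
    · rw [val_finRotate_of_add_one_eq hx]
      push_cast
      omega
    · rw [val_finRotate_of_add_one_lt (by omega)]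
      push_cast
      omega
  induction h with
  | one =>
    exact ⟨1, fun _ => 1, fun _ => 0, fun _ => 0, fun _ _ => rfl, fun x => by simp,
      fun _ => HasExp.one, by simp⟩
  | gen_a =>
    refine ⟨finRotate m, _, fun x => if x.val + 1 = m then 1 else 0, fun _ => 0, a_cons,
      fun x => by simpa using hδ x, fun x => ?_, by simp⟩
    dsimp only
    split_ifs
    · exact gen_a
    · exact one
  | gen_b =>
    refine ⟨finRotate m, _, fun x => if x.val + 1 = m then 1 else 0,
      fun x => if x.val + 1 = m then -1 else 0, b_cons,
      fun x => by simpa using hδ x, fun x => ?_, ?_⟩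
    · dsimp only
      split_ifs
      · exact gen_b.inv
      · exact one
    · obtain _ | m := m
      · exact absurd hm (lt_irrefl 0)
      · rw [Finset.sum_eq_single (Fin.last m)]
        · simp
        · intro x _ hx
          rw [if_neg]
          intro h
          exact hx (Fin.ext (by simp; omega))
        · simp
  | @mul f g A B C D _ _ ih1 ih2 =>
    obtain ⟨π, s, δ, t, h1, h2, h3, h4⟩ := ih1
    obtain ⟨ρ, r, ε, v, k1, k2, k3, k4⟩ := ih2
    refine ⟨π * ρ, fun x => s (ρ x) * r x, fun x => δ (ρ x) + ε x, fun x => t (ρ x) + v x,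
      fun x u => ?_, fun x => ?_, fun x => ?_, ?_⟩
    · rw [RelIso.mul_apply, k1, h1]
      rfl
    · have e1 := h2 (ρ x)
      have e2 := k2 x
      rw [Equiv.Perm.mul_apply]
      linear_combination e1 + e2
    · exact ((h3 (ρ x)).mul (k3 x)).cast (by ring) rfl
    · rw [Finset.sum_add_distrib, Equiv.sum_comp ρ t, h4, k4]
      ring
  | @inv g A B _ ih =>
    obtain ⟨π, s, δ, t, h1, h2, h3, h4⟩ := ih
    have hπ : ∀ x, π (π⁻¹ x) = x := π.apply_symm_apply
    refine ⟨π⁻¹, fun x => (s (π⁻¹ x))⁻¹, fun x => -δ (π⁻¹ x), fun x => -t (π⁻¹ x),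
      fun x u => ?_, fun x => ?_, fun x => ?_, ?_⟩
    · have : g (π⁻¹ x :: (s (π⁻¹ x))⁻¹ u) = x :: u := by
        rw [h1, RelIso.apply_inv_self, hπ]
      rw [← this, RelIso.inv_apply_self]
    · have e1 := h2 (π⁻¹ x)
      rw [hπ] at e1
      linear_combination -e1
    · exact (h3 (π⁻¹ x)).inv.cast (by ring) rfl
    · rw [Finset.sum_neg_distrib, Equiv.sum_comp π⁻¹ t, h4]

/-- The sections of an element of `St (n + 1)` and their exponent sums. -/
theorem sections_of_mem_St {g : AutT m} {A B : ℤ} (hm : 0 < m) (h : HasExp m g A B) {n : ℕ}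
    (hg : g ∈ St m (n + 1)) :
    ∃ (s : Fin m → AutT m) (δ : ℤ) (t : Fin m → ℤ),
      (∀ x u, g (x :: u) = x :: s x u) ∧ A + B = m * δ ∧
      (∀ x, s x ∈ St m n) ∧ (∀ x, HasExp m (s x) (δ + t x) (t x)) ∧ ∑ x, t x = -B := by
  obtain ⟨π, s, δ, t, h1, h2, h3, h4⟩ := h.sections hm
  have key : ∀ x u, u.length = n → π x = x ∧ s x u = u := by
    intro x u hu
    have := hg (x :: u) (by simp [hu])
    rw [h1] at this
    exact List.cons.inj this
  have hπ : ∀ x, π x = x := fun x => (key x (List.replicate n x) (by simp)).1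
  have hδ : ∀ x, A + B = m * δ x := fun x => by
    have := h2 x
    rw [hπ] at this
    linarith
  -- When the first level is fixed, the carry is `(A + B) / m` at every letter.
  have hδ' : ∀ x, δ x = δ ⟨0, hm⟩ := fun x => by
    have := (hδ x).symm.trans (hδ ⟨0, hm⟩)
    exact mul_left_cancel₀ (by exact_mod_cast hm.ne') this
  refine ⟨s, δ ⟨0, hm⟩, t, fun x u => ?_, hδ _, fun x u hu => (key x u hu).2, fun x => ?_, h4⟩
  · rw [h1, hπ]
  · rw [← hδ' x]
    exact h3 x

end HasExp

/-! ### Elements with prescribed first level sections -/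

theorem zpow_cons {g h : AutT m} {x : Fin m} (H : ∀ u, g (x :: u) = x :: h u) (i : ℤ)
    (u : List (Fin m)) : (g ^ i) (x :: u) = x :: (h ^ i) u := by
  have hn : ∀ (i : ℕ) u, (g ^ i) (x :: u) = x :: (h ^ i) u := by
    intro i
    induction i with
    | zero => intro u; rfl
    | succ i ih =>
      intro u
      rw [pow_succ, pow_succ, RelIso.mul_apply, RelIso.mul_apply, H, ih]
  obtain ⟨i, rfl | rfl⟩ := i.eq_nat_or_neg
  · simpa using hn i u
  · simp only [zpow_neg, zpow_natCast]
    have := hn i ((h ^ i)⁻¹ u)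
    rw [RelIso.apply_inv_self] at this
    rw [← this, RelIso.inv_apply_self]

theorem a_pow_cons (i : ℕ) {x y : Fin m} (h : x.val + i = y.val) (u : List (Fin m)) :
    (a m ^ i) (x :: u) = y :: u := by
  induction i generalizing x with
  | zero =>
    obtain rfl : x = y := Fin.ext h
    rfl
  | succ i ih =>
    have hy := y.isLt
    rw [pow_succ, RelIso.mul_apply, a_cons, if_neg (by omega)]
    exact ih (by rw [val_finRotate_of_add_one_lt (by omega)]; omega)

theorem a_pow_card_cons (x : Fin m) (u : List (Fin m)) : (a m ^ m) (x :: u) = x :: a m u := by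
  have hx := x.isLt
  -- Climb to the last letter, carry once, then climb back to `x`: the section is a single `a`.
  have e : a m ^ m = a m ^ x.val * (a m * a m ^ (m - 1 - x.val)) := by
    rw [← pow_succ', ← pow_add]
    congr 1
    omega
  rw [e, RelIso.mul_apply, RelIso.mul_apply,
    a_pow_cons _ (y := ⟨m - 1, by omega⟩) (by simp; omega), a_cons, if_pos (by simp; omega)]
  exact a_pow_cons _ (by rw [val_finRotate_of_add_one_eq (by simp; omega)]; omega) _

theorem a_zpow_mul_card_cons (i : ℤ) (x : Fin m) (u : List (Fin m)) :
    (a m ^ (m * i)) (x :: u) = x :: (a m ^ i) u := by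
  rw [zpow_mul, zpow_natCast]
  exact zpow_cons (a_pow_card_cons x) i u

/-- `g` fixes the first level, its section at `x` is `h`, and its other sections are trivial. -/
def ActsAt (x : Fin m) (h g : AutT m) : Prop :=
  ∀ y u, g (y :: u) = y :: (if y = x then h else 1) u

theorem ActsAt.one (x : Fin m) : ActsAt x 1 1 := fun y u => by simp

theorem ActsAt.mul {x : Fin m} {h h' g g' : AutT m} (H : ActsAt x h g) (H' : ActsAt x h' g') :
    ActsAt x (h * h') (g * g') := fun y u => by
  rw [RelIso.mul_apply, H', H]
  split_ifs <;> rfl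

theorem ActsAt.inv {x : Fin m} {h g : AutT m} (H : ActsAt x h g) : ActsAt x h⁻¹ g⁻¹ :=
  fun y u => by
  have h1 := H y ((if y = x then h else 1)⁻¹ u)
  rw [RelIso.apply_inv_self] at h1
  rw [← h1, RelIso.inv_apply_self]
  split_ifs <;> simp

/-- Since `a ^ m` has section `a` at every letter, the section at `x` is conjugated by `a ^ i`,
while trivial sections stay trivial. -/
theorem ActsAt.conj_a {x : Fin m} {h g : AutT m} (H : ActsAt x h g) (i : ℤ) :
    ActsAt x (a m ^ i * h * a m ^ (-i)) (a m ^ (m * i) * g * a m ^ (m * (-i))) := fun y u => by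
  rw [RelIso.mul_apply, RelIso.mul_apply, a_zpow_mul_card_cons, H, a_zpow_mul_card_cons]
  split_ifs
  · rfl
  · rw [← RelIso.mul_apply, ← RelIso.mul_apply, mul_one, ← zpow_add, add_neg_cancel, zpow_zero]

/-- In `b⁻¹ * a` the two rotations cancel and only the sections at the last letter survive, giving
`(b⁻¹)⁻¹ * a`; conjugating by a power of `a` moves this to `x`. -/
theorem exists_actsAt_b_mul_a (x : Fin m) :
    ∃ g, HasExp m g 1 (-1) ∧ ActsAt x (b m * a m) g := by
  have hx := x.isLt
  have hc : ActsAt ⟨m - 1, by omega⟩ (b m * a m) ((b m)⁻¹ * a m) := by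
    intro y u
    rw [RelIso.mul_apply, a_cons]
    have := b_cons y ((if y.val + 1 = m then (b m)⁻¹ else 1)⁻¹
      ((if y.val + 1 = m then a m else 1) u))
    rw [RelIso.apply_inv_self] at this
    rw [← this, RelIso.inv_apply_self]
    by_cases h : y.val + 1 = m
    · rw [if_pos h, if_pos h, if_pos (Fin.ext (by simp; omega)), inv_inv]
      rfl
    · rw [if_neg h, if_neg h, if_neg (fun h' => h (by rw [h']; simp; omega))]
      rfl
  have ha := HasExp.gen_a (m := m)
  refine ⟨(a m ^ (m - 1 - x.val))⁻¹ * ((b m)⁻¹ * a m) * a m ^ (m - 1 - x.val), ?_, ?_⟩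
  · exact (((ha.pow _).inv.mul (HasExp.gen_b.inv.mul ha)).mul (ha.pow _)).cast
      (by ring) (by ring)
  · intro y u
    set i := m - 1 - x.val with hi
    have hlast : ∀ u, (a m ^ i) (x :: u) = ⟨m - 1, by omega⟩ :: u :=
      a_pow_cons _ (by simp; omega)
    by_cases hy : y = x
    · subst hy
      rw [if_pos rfl, RelIso.mul_apply, RelIso.mul_apply, hlast, hc, if_pos rfl, ← hlast,
        RelIso.inv_apply_self]
    · obtain ⟨π, s, -, -, h1, -, -, -⟩ := (ha.pow i).sections (by omega)
      have hπ : π y ≠ ⟨m - 1, by omega⟩ := by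
        intro h
        apply hy
        apply π.injective
        have e1 := h1 x []
        rw [hlast] at e1
        exact h.trans (List.cons.inj e1).1
      have e := h1 y u
      rw [if_neg hy, RelIso.mul_apply, RelIso.mul_apply, e, hc, if_neg hπ]
      rw [RelIso.one_apply, ← e, RelIso.inv_apply_self]
      rfl

/-- Up to a power of `a`, an element of the group acts at a given letter of the first level. -/
theorem HasExp.exists_actsAt {h : AutT m} {A B : ℤ} (H : HasExp m h A B) (x : Fin m) :
    ∃ g, HasExp m g B (-B) ∧ ActsAt x (h * a m ^ (B - A)) g := by
  have hconj : ∀ (i : ℤ) {g : AutT m} {C D : ℤ}, HasExp m g C D →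
      HasExp m (a m ^ (m * i) * g * a m ^ (m * (-i))) C D := fun i g C D hg =>
    (((gen_a.zpow _).mul hg).mul (gen_a.zpow _)).cast (by ring) (by ring)
  induction H with
  | one => exact ⟨1, one, by simpa using ActsAt.one x⟩
  | gen_a => exact ⟨1, one, by simpa using ActsAt.one x⟩
  | gen_b => simpa using exists_actsAt_b_mul_a x
  | @mul h k A B C D _ _ ih1 ih2 =>
    obtain ⟨f, f1, f2⟩ := ih1
    obtain ⟨g, g1, g2⟩ := ih2
    -- The conjugation moves the correcting power `a ^ (B - A)` of the first factor past the second
    -- one without changing exponents.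
    refine ⟨_, (f1.mul (hconj (A - B) g1)).cast rfl (by ring), ?_⟩
    convert f2.mul (g2.conj_a (A - B)) using 1
    have e1 : a m ^ (B - A) = (a m ^ (A - B))⁻¹ := by
      rw [← zpow_neg]
      congr 1
      ring
    have e2 : a m ^ (B + D - (A + C)) = a m ^ (D - C) * a m ^ (-(A - B)) := by
      rw [← zpow_add]
      congr 1
      ring
    rw [e1, e2]
    simp only [mul_assoc, inv_mul_cancel_left]
  | @inv h A B _ ih =>
    obtain ⟨g, g1, g2⟩ := ih
    refine ⟨_, hconj (B - A) g1.inv, ?_⟩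
    convert g2.inv.conj_a (B - A) using 1
    rw [mul_inv_rev, ← zpow_neg, ← mul_assoc, ← zpow_add, add_neg_cancel, zpow_zero, one_mul]
    congr 2
    ring

/-- An element with prescribed sections on the first level. -/
theorem exists_hasExp_of_sections (s : ℤ) (t : Fin m → ℤ) (h : Fin m → AutT m)
    (H : ∀ x, HasExp m (h x) (s + t x) (t x)) :
    ∃ g, HasExp m g (m * s + ∑ x, t x) (-∑ x, t x) ∧ ∀ x u, g (x :: u) = x :: h x u := by
  -- The common part `a ^ s` of the sections is split off here and restored at the end by the factor
  -- `a ^ (m * s)`.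
  have key : ∀ F : Finset (Fin m), ∃ g, HasExp m g (∑ x ∈ F, t x) (-∑ x ∈ F, t x) ∧
      ∀ x u, g (x :: u) = x :: (if x ∈ F then h x * a m ^ (-s) else 1) u := by
    intro F
    induction F using Finset.induction_on with
    | empty => exact ⟨1, HasExp.one, fun x u => by simp⟩
    | insert x F hx ih =>
      obtain ⟨g, g1, g2⟩ := ih
      obtain ⟨f, f1, f2⟩ := (H x).exists_actsAt x
      rw [show t x - (s + t x) = -s by ring] at f2
      refine ⟨f * g, (f1.mul g1).cast ?_ ?_, fun y u => ?_⟩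
      · rw [Finset.sum_insert hx]
      · rw [Finset.sum_insert hx]
        ring
      · rw [RelIso.mul_apply, g2, f2]
        by_cases hy : y = x
        · subst hy
          simp [hx]
        · simp [hy]
  obtain ⟨g, g1, g2⟩ := key Finset.univ
  refine ⟨g * a m ^ (m * s), (g1.mul (HasExp.gen_a.zpow _)).cast (by ring) (by ring),
    fun x u => ?_⟩
  rw [RelIso.mul_apply, a_zpow_mul_card_cons, g2, if_pos (Finset.mem_univ x), zpow_neg,
    RelIso.mul_apply, RelIso.inv_apply_self]

/-! ### Arithmetic of the exponents occurring in level stabilizers -/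

/-- The exponent sums of the elements of `St n`, described recursively. -/
def StExp (m : ℕ) : ℕ → ℤ → ℤ → Prop
  | 0, _, _ => True
  | n + 1, A, B => ∃ (s : ℤ) (t : Fin m → ℤ), A + B = m * s ∧
      (∀ x, StExp m n (s + t x) (t x)) ∧ ∑ x, t x = -B

theorem stExp_iff (hm : 0 < m) (n : ℕ) (A B : ℤ) :
    StExp m n A B ↔ ∃ g ∈ St m n, HasExp m g A B := by
  induction n generalizing A B with
  | zero =>
    refine ⟨fun _ => ⟨a m ^ A * b m ^ B, fun v hv => ?_, ?_⟩, fun _ => trivial⟩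
    · rw [List.length_eq_zero_iff.1 hv]
      exact ((HasExp.gen_a.zpow A).mul (HasExp.gen_b.zpow B)).apply_nil
    · exact ((HasExp.gen_a.zpow A).mul (HasExp.gen_b.zpow B)).cast (by ring) (by ring)
  | succ n ih =>
    constructor
    · rintro ⟨s, t, h1, h2, h3⟩
      choose h hS hE using fun x => (ih _ _).1 (h2 x)
      obtain ⟨g, g1, g2⟩ := exists_hasExp_of_sections s t h hE
      refine ⟨g, fun v hv => ?_, g1.cast (by linarith) (by linarith)⟩
      obtain _ | ⟨x, u⟩ := v
      · simp at hv
      · rw [g2, hS x u (by simpa using hv)]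
    · rintro ⟨g, hS, hE⟩
      obtain ⟨h, s, t, -, h2, h3, h4, h5⟩ := hE.sections_of_mem_St hm hS
      exact ⟨s, t, h2, fun x => (ih _ _).2 ⟨h x, h3 x, h4 x⟩, h5⟩

theorem exists_sum_eq_of_dvd (hm : 0 < m) {M c s w : ℤ} (hM : M ∣ m) (hc : IsCoprime c M)
    (hw : M ∣ w) : ∃ u : Fin m → ℤ, (∀ x, M ∣ s + c * u x) ∧ ∑ x, u x = w := by
  obtain ⟨p, q, hpq⟩ := hc
  have h0 : M ∣ s + c * (-s * p) := ⟨s * q, by linear_combination (-s) * hpq⟩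
  -- A constant solution of the congruence, corrected at one letter to reach the sum `w`; the
  -- correction is divisible by `M` because `M` divides both `w` and `m`.
  refine ⟨fun x => -s * p + if x = ⟨0, hm⟩ then w - m * (-s * p) else 0, fun x => ?_, ?_⟩
  · dsimp only
    rw [mul_add, ← add_assoc]
    refine dvd_add h0 (Dvd.dvd.mul_left ?_ _)
    split_ifs
    · exact dvd_sub hw (hM.mul_right _)
    · exact dvd_zero _
  · rw [Finset.sum_add_distrib]
    simp

theorem dvd_sum_of_forall_dvd {M c s : ℤ} (hM : M ∣ m) (hc : IsCoprime c M) {u : Fin m → ℤ}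
    (h : ∀ x, M ∣ s + c * u x) : M ∣ ∑ x, u x := by
  refine hc.symm.dvd_of_dvd_mul_left ?_
  have h1 : M ∣ ∑ x, (s + c * u x) := Finset.dvd_sum fun x _ => h x
  rw [Finset.sum_add_distrib, ← Finset.mul_sum] at h1
  simp only [Finset.sum_const, Finset.card_univ, Fintype.card_fin, nsmul_eq_mul] at h1
  exact (dvd_add_right (hM.mul_right s)).1 h1

/-- Passage from level `2r + 1` to `2r + 2`, with `c = m ^ r`. Writing `t = c * u` and `s = c * g *
s'`, the condition becomes `s' + g' * u ≡ 0` modulo `q`; as `q ∣ m`, the sums `∑ u` so obtained are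
exactly the multiples of `q`. -/
theorem stExp_step_odd (hm : 0 < m) {c g g' q : ℤ} (hc : c ≠ 0) (hg : g * q = m) (h2 : g * g' = 2)
    (hq : IsCoprime g' q) (A B : ℤ) :
    (∃ (s : ℤ) (t : Fin m → ℤ), A + B = m * s ∧
      (∀ x, c ∣ t x ∧ c * m ∣ s + t x + t x) ∧ ∑ x, t x = -B) ↔
    c * q ∣ B ∧ c * m * g ∣ A + B := by
  have hg0 : g ≠ 0 := by rintro rfl; simp at h2
  have hm' : (m : ℤ) ≠ 0 := by exact_mod_cast hm.ne'
  constructor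
  · rintro ⟨s, t, h, ht, hs⟩
    choose u hu using fun x => (ht x).1
    choose v hv using fun x => (ht x).2
    have hsv : ∀ x, s = c * g * (q * v x - g' * u x) := fun x => by
      linear_combination hv x - 2 * hu x - c * v x * hg + c * u x * h2
    obtain ⟨s', rfl⟩ : c * g ∣ s := ⟨_, hsv ⟨0, hm⟩⟩
    refine ⟨?_, s', by rw [h]; ring⟩
    have hd : q ∣ ∑ x, u x := by
      refine dvd_sum_of_forall_dvd (c := g') (s := s') ⟨g, by rw [← hg]; ring⟩ hq fun x => ⟨v x, ?_⟩
      have := mul_left_cancel₀ (mul_ne_zero hc hg0) (hsv x)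
      linear_combination this
    rw [← dvd_neg, ← hs, Finset.sum_congr rfl fun x _ => hu x, ← Finset.mul_sum]
    exact mul_dvd_mul_left c hd
  · rintro ⟨⟨w, hw⟩, ⟨s, hs⟩⟩
    obtain ⟨u, hu, hu'⟩ := exists_sum_eq_of_dvd hm (M := q) (c := g') (s := s) (w := -(q * w))
      ⟨g, by rw [← hg]; ring⟩ hq (by simp)
    refine ⟨c * g * s, fun x => c * u x, by rw [hs]; ring, fun x => ⟨⟨_, rfl⟩, ?_⟩, ?_⟩
    · obtain ⟨v, hv⟩ := hu x
      exact ⟨v, by linear_combination c * g * hv + c * v * hg - c * u x * h2⟩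
    · rw [← Finset.mul_sum, hu', hw]
      ring

/-- Passage from level `2r + 2` to `2r + 3`, with `c = m ^ r`: the same argument for `t = c * q *
u`, `s = c * m * s'` and the congruence `s' + g' * u ≡ 0` modulo `g`. -/
theorem stExp_step_even (hm : 0 < m) {c g g' q : ℤ} (hc : c ≠ 0) (hg : g * q = m)
    (h2 : g * g' = 2) (hq : IsCoprime g' g) (A B : ℤ) :
    (∃ (s : ℤ) (t : Fin m → ℤ), A + B = m * s ∧
      (∀ x, c * q ∣ t x ∧ c * m * g ∣ s + t x + t x) ∧ ∑ x, t x = -B) ↔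
    c * m ∣ B ∧ c * m * m ∣ A + B := by
  have hm' : (m : ℤ) ≠ 0 := by exact_mod_cast hm.ne'
  constructor
  · rintro ⟨s, t, h, ht, hs⟩
    choose u hu using fun x => (ht x).1
    choose v hv using fun x => (ht x).2
    have hsv : ∀ x, s = c * m * (g * v x - g' * u x) := fun x => by
      linear_combination hv x - 2 * hu x + c * q * u x * h2 - c * g' * u x * hg
    obtain ⟨s', rfl⟩ : c * m ∣ s := ⟨_, hsv ⟨0, hm⟩⟩
    refine ⟨?_, s', by rw [h]; ring⟩
    have hd : g ∣ ∑ x, u x := by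
      refine dvd_sum_of_forall_dvd (c := g') (s := s') ⟨q, by rw [← hg]⟩ hq fun x => ⟨v x, ?_⟩
      have := mul_left_cancel₀ (mul_ne_zero hc hm') (hsv x)
      linear_combination this
    rw [← dvd_neg, ← hs, Finset.sum_congr rfl fun x _ => hu x, ← Finset.mul_sum, ← hg,
      mul_comm g q, ← mul_assoc]
    exact mul_dvd_mul_left _ hd
  · rintro ⟨⟨w, hw⟩, ⟨s, hs⟩⟩
    obtain ⟨u, hu, hu'⟩ := exists_sum_eq_of_dvd hm (M := g) (c := g') (s := s) (w := -(g * w))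
      ⟨q, by rw [← hg]⟩ hq (by simp)
    refine ⟨c * m * s, fun x => c * q * u x, by rw [hs]; ring, fun x => ⟨⟨_, rfl⟩, ?_⟩, ?_⟩
    · obtain ⟨v, hv⟩ := hu x
      exact ⟨v, by linear_combination c * m * hv - c * q * u x * h2 + c * g' * u x * hg⟩
    · rw [← Finset.mul_sum, hu', hw, ← hg]
      ring

/-- `2 = gcd(2, m) * g'` and `m = gcd(2, m) * q` with `g'` prime to `q` and to `gcd(2, m)`. -/
theorem exists_two_eq (m : ℕ) : ∃ q : ℕ, m = 2 ^ τ m * q ∧ ∃ g' : ℤ, 2 ^ τ m * g' = 2 ∧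
    IsCoprime g' q ∧ IsCoprime g' (2 ^ τ m) := by
  unfold τ
  split_ifs with h
  · refine ⟨m, by simp, 2, by simp, ?_, by simp⟩
    obtain ⟨j, rfl⟩ := h
    exact ⟨-j, 1, by push_cast; ring⟩
  · obtain ⟨j, rfl⟩ := Nat.not_odd_iff_even.1 h
    exact ⟨j, by ring, 1, by simp, isCoprime_one_left, isCoprime_one_left⟩

theorem stExp_odd_even (hm : 0 < m) {g g' q : ℤ} (hg : g * q = m) (h2 : g * g' = 2)
    (hq : IsCoprime g' q) (hq' : IsCoprime g' g) (r : ℕ) (A B : ℤ) :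
    (StExp m (2 * r + 1) A B ↔ (m : ℤ) ^ r ∣ B ∧ (m : ℤ) ^ r * m ∣ A + B) ∧
    (StExp m (2 * r + 2) A B ↔ (m : ℤ) ^ r * q ∣ B ∧ (m : ℤ) ^ r * m * g ∣ A + B) := by
  have hm' : (m : ℤ) ≠ 0 := by exact_mod_cast hm.ne'
  have heven : ∀ r, (∀ A B, StExp m (2 * r + 1) A B ↔
        (m : ℤ) ^ r ∣ B ∧ (m : ℤ) ^ r * m ∣ A + B) →
      ∀ A B, (StExp m (2 * r + 2) A B ↔ (m : ℤ) ^ r * q ∣ B ∧ (m : ℤ) ^ r * m * g ∣ A + B) := by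
    intro r h A B
    rw [← stExp_step_odd hm (pow_ne_zero r hm') hg h2 hq, StExp]
    simp only [h]
  have hodd : ∀ r A B, StExp m (2 * r + 1) A B ↔
      (m : ℤ) ^ r ∣ B ∧ (m : ℤ) ^ r * m ∣ A + B := by
    intro r
    induction r with
    | zero =>
      intro A B
      simp only [mul_zero, zero_add, pow_zero, one_dvd, true_and, one_mul]
      constructor
      · rintro ⟨s, t, h, -, -⟩
        exact ⟨s, h⟩
      · rintro ⟨s, h⟩
        obtain ⟨u, -, hu⟩ := exists_sum_eq_of_dvd hm (M := 1) (c := 1) (s := 0) (w := -B)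
          (one_dvd _) isCoprime_one_left (one_dvd _)
        exact ⟨s, u, h, fun _ => trivial, hu⟩
    | succ r ih =>
      intro A B
      rw [pow_succ, ← stExp_step_even hm (pow_ne_zero r hm') hg h2 hq',
        show 2 * (r + 1) + 1 = 2 * r + 2 + 1 by ring, StExp]
      simp only [heven r ih]
  exact ⟨hodd r A B, heven r (hodd r) A B⟩

/-- The exponents `(t, t)` which occur in `St (n - 1)`. -/
theorem stExp_diag_iff (hm : 0 < m) {n : ℕ} (hn : 2 ≤ n) :
    ∃ d : ℕ, d * 2 ^ (e (n - 1) * τ m) = m ^ k n ∧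
      ∀ t : ℤ, StExp m (n - 1) t t ↔ (d : ℤ) ∣ t := by
  obtain ⟨q, hg, g', h2, hq, hq'⟩ := exists_two_eq m
  set g : ℕ := 2 ^ τ m with hgdef
  have hg1 : (g : ℤ) * q = m := by rw [hg]; push_cast; rfl
  have h2' : (g : ℤ) * g' = 2 := by rw [← h2, hgdef]; push_cast; rfl
  have hq2 : IsCoprime g' (g : ℤ) := by rw [hgdef]; push_cast; exact hq'
  have hg0 : (g : ℤ) ≠ 0 := by intro h; simp [h] at h2'
  have hm' : (m : ℤ) ≠ 0 := by exact_mod_cast hm.ne'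
  have key := stExp_odd_even hm hg1 h2' hq hq2
  -- On the diagonal `A + B = 2 * t`. At level `2r + 1` this requires `m ∣ 2 * w` for `t = m ^ r *
  -- w`, i.e. `q ∣ w`, which is the source of the factor `2` for even `m`.
  obtain ⟨r, hr | hr⟩ : ∃ r, n = 2 * r + 2 ∨ n = 2 * r + 3 := ⟨(n - 2) / 2, by omega⟩
  · have hk : k n = r + 1 := by unfold k; omega
    have he : e (n - 1) = 1 := by unfold e k; omega
    refine ⟨m ^ r * q, ?_, fun t => ?_⟩
    · rw [hk, he, one_mul, ← hgdef, pow_succ, mul_assoc, mul_comm q, ← hg]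
    · rw [show n - 1 = 2 * r + 1 by omega, (key r t t).1]
      push_cast
      constructor
      · rintro ⟨⟨w, rfl⟩, v, hv⟩
        have : (m : ℤ) ^ r * g * (g' * w) = (m : ℤ) ^ r * g * (q * v) := by
          linear_combination hv + (m : ℤ) ^ r * w * h2' - (m : ℤ) ^ r * v * hg1
        have h := mul_left_cancel₀ (mul_ne_zero (pow_ne_zero r hm') hg0) this
        exact mul_dvd_mul_left _ (hq.symm.dvd_of_dvd_mul_left ⟨v, h⟩)
      · rintro ⟨w, rfl⟩
        refine ⟨⟨q * w, by ring⟩, ⟨g' * w, ?_⟩⟩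
        linear_combination (m : ℤ) ^ r * g' * w * hg1 - (m : ℤ) ^ r * q * w * h2'
  · have hk : k n = r + 1 := by unfold k; omega
    have he : e (n - 1) = 0 := by unfold e k; omega
    refine ⟨m ^ (r + 1), by rw [hk, he]; simp, fun t => ?_⟩
    rw [show n - 1 = 2 * r + 2 by omega, (key r t t).2]
    push_cast
    constructor
    · rintro ⟨⟨w, rfl⟩, v, hv⟩
      have : (m : ℤ) ^ r * m * (g' * w) = (m : ℤ) ^ r * m * (g * v) := by
        linear_combination hv - (m : ℤ) ^ r * g' * w * hg1 + (m : ℤ) ^ r * q * w * h2'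
      have h := mul_left_cancel₀ (mul_ne_zero (pow_ne_zero r hm') hm') this
      obtain ⟨z, rfl⟩ := hq2.symm.dvd_of_dvd_mul_left ⟨v, h⟩
      exact ⟨z, by rw [pow_succ, ← hg1]; ring⟩
    · rintro ⟨w, rfl⟩
      exact ⟨⟨g * w, by rw [pow_succ, ← hg1]; ring⟩, ⟨g' * w, by
        rw [pow_succ]; linear_combination (-(m : ℤ) ^ r * m * w) * h2'⟩⟩

/-! ### Exponent sums are well defined and detect `H'` -/

/-- The identity lies in every `St m n`, so `B` and `A + B` are divisible by all powers of `m`. -/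
theorem HasExp.eq_zero (hm : 2 ≤ m) {A B : ℤ} (h : HasExp m 1 A B) : A = 0 ∧ B = 0 := by
  have hpow : ∀ C : ℤ, (∀ r : ℕ, (m : ℤ) ^ r ∣ C) → C = 0 := by
    intro C hC
    refine Int.eq_zero_of_abs_lt_dvd (hC C.natAbs) ?_
    rw [Int.abs_eq_natAbs]
    exact_mod_cast Nat.lt_pow_self (by omega)
  obtain ⟨q, hg, g', h2, hq, hq'⟩ := exists_two_eq m
  have key : ∀ r : ℕ, (m : ℤ) ^ r ∣ B ∧ (m : ℤ) ^ r * m ∣ A + B := fun r =>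
    (stExp_odd_even (by omega) (g := 2 ^ τ m) (q := q) (by exact_mod_cast hg.symm) h2 hq hq' r
      A B).1.1 ((stExp_iff (by omega) _ _ _).2 ⟨1, one_mem _, h⟩)
  have hB := hpow B fun r => (key r).1
  have hA := hpow (A + B) fun r => (dvd_mul_right _ _).trans (key r).2
  exact ⟨by omega, hB⟩

/-- The exponent sums are determined by the element. -/
theorem HasExp.unique (hm : 2 ≤ m) {g : AutT m} {A B C D : ℤ} (h : HasExp m g A B)
    (h' : HasExp m g C D) : A = C ∧ B = D := by
  have := (h.mul h'.inv).cast rfl rfl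
  rw [mul_inv_cancel] at this
  have := this.eq_zero hm
  omega

theorem HasExp.mem_H {g : AutT m} {A B : ℤ} (h : HasExp m g A B) : g ∈ H m := by
  induction h with
  | one => exact one_mem _
  | gen_a => exact Subgroup.subset_closure (by simp)
  | gen_b => exact Subgroup.subset_closure (by simp)
  | mul _ _ h1 h2 => exact mul_mem h1 h2
  | inv _ h => exact inv_mem h

theorem exists_hasExp {g : AutT m} (h : g ∈ H m) : ∃ A B, HasExp m g A B := by
  induction h using Subgroup.closure_induction with
  | mem x hx =>
    obtain rfl | rfl := hx
    · exact ⟨_, _, HasExp.gen_a⟩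
    · exact ⟨_, _, HasExp.gen_b⟩
  | one => exact ⟨_, _, HasExp.one⟩
  | mul x y _ _ h1 h2 =>
    obtain ⟨A, B, h1⟩ := h1
    obtain ⟨C, D, h2⟩ := h2
    exact ⟨_, _, h1.mul h2⟩
  | inv x _ h =>
    obtain ⟨A, B, h⟩ := h
    exact ⟨_, _, h.inv⟩

theorem HasExp.abelianization {g : AutT m} {A B : ℤ} (h : HasExp m g A B) :
    Abelianization.of (⟨g, h.mem_H⟩ : H m) =
      Abelianization.of ⟨a m, HasExp.gen_a.mem_H⟩ ^ A *
        Abelianization.of ⟨b m, HasExp.gen_b.mem_H⟩ ^ B := by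
  induction h with
  | one =>
    rw [zpow_zero, zpow_zero, mul_one]
    exact map_one Abelianization.of
  | gen_a => simp
  | gen_b => simp
  | mul h1 h2 ih1 ih2 =>
    rw [← MulMemClass.mk_mul_mk _ _ _ h1.mem_H h2.mem_H, map_mul, ih1, ih2, zpow_add, zpow_add,
      mul_mul_mul_comm]
  | inv h ih =>
    have : Abelianization.of (⟨_, h.inv.mem_H⟩ : H m) = (Abelianization.of ⟨_, h.mem_H⟩)⁻¹ := by
      rw [← map_inv]
      rfl
    rw [this, ih, mul_inv, zpow_neg, zpow_neg]

/-- Exponent sums cancel in commutators; conversely, the class of an element in the abelianization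
depends only on its exponents. -/
theorem mem_H'_iff {g : AutT m} : g ∈ H' m ↔ HasExp m g 0 0 := by
  constructor
  · intro h
    let K : Subgroup (AutT m) :=
      { carrier := {g | HasExp m g 0 0}
        one_mem' := HasExp.one
        mul_mem' := fun h1 h2 => (HasExp.mul h1 h2).cast (by ring) (by ring)
        inv_mem' := fun h => (HasExp.inv h).cast (by ring) (by ring) }
    refine (Subgroup.commutator_le.2 fun f hf g hg => ?_ : ⁅H m, H m⁆ ≤ K) h
    obtain ⟨A, B, hf⟩ := exists_hasExp hf
    obtain ⟨C, D, hg⟩ := exists_hasExp hg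
    exact (((hf.mul hg).mul hf.inv).mul hg.inv).cast (by ring) (by ring)
  · intro h
    have h1 := h.abelianization
    rw [zpow_zero, zpow_zero, mul_one] at h1
    have h2 : (⟨g, h.mem_H⟩ : H m) ∈ commutator (H m) := by
      rw [← Abelianization.ker_of]
      exact h1
    have h3 := Subgroup.mem_map_of_mem (H m).subtype h2
    rwa [Subgroup.map_subtype_commutator] at h3

/-! ### Sections of elements of `H'` and the subgroup `L₂` -/

/-- The exponents of the first level sections of an element of the commutator subgroup. -/
theorem exists_sections_of_mem_H' (hm : 0 < m) {g : AutT m} (hg : g ∈ H' m) :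
    ∃ (s : Fin m → AutT m) (t : Fin m → ℤ), (∀ x u, g (x :: u) = x :: s x u) ∧
      (∀ x, HasExp m (s x) (t x) (t x)) ∧ ∑ x, t x = 0 := by
  rw [mem_H'_iff] at hg
  obtain ⟨π, s, δ, t, h1, h2, h3, h4⟩ := hg.sections hm
  have key : ∀ x, π x = x ∧ δ x = 0 := by
    intro x
    have e1 := h2 x
    have l1 := x.isLt
    have l2 := (π x).isLt
    -- Two letters differ by less than `m`, so `x = π x + m * δ x` leaves no room for a carry.
    have : δ x = 0 := by
      by_contra h
      have : (m : ℤ) * 1 ≤ m * |δ x| :=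
        mul_le_mul_of_nonneg_left (Int.one_le_abs h) (by positivity)
      obtain h' | h' := abs_choice (δ x) <;> rw [h'] at this <;> linarith
    rw [this] at e1
    exact ⟨Fin.ext (by omega), this⟩
  refine ⟨s, t, fun x u => ?_, fun x => ?_, by simpa using h4⟩
  · rw [h1, (key x).1]
  · simpa [(key x).2] using h3 x

theorem eq_one_of_forall_cons {g : AutT m} (h : ∀ x u, g (x :: u) = x :: u) : g = 1 := by
  apply RelIso.ext
  rintro (_ | ⟨x, u⟩)
  · obtain hg | ⟨x, u, hg⟩ : g [] = [] ∨ ∃ x u, g [] = x :: u := by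
      cases g [] <;> simp
    · exact hg
    · have := g.injective (hg.trans (h x u).symm)
      simp at this
  · exact h x u

theorem mem_psiInv_iff {K : Subgroup (AutT m)} (hK : ∀ h ∈ K, h [] = []) {g : AutT m} :
    g ∈ psiInv K ↔ ∃ s : Fin m → AutT m, (∀ x, s x ∈ K) ∧ ∀ x u, g (x :: u) = x :: s x u := by
  constructor
  · rintro ⟨h1, h2⟩
    choose s hs hs' using h2
    refine ⟨s, hs, fun x u => ?_⟩
    have := hs' x u
    rwa [h1 [x] rfl] at this
  · rintro ⟨s, hs, h⟩
    have h1 : ∀ x, g [x] = [x] := fun x => by rw [h, hK _ (hs x)]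
    refine ⟨fun v hv => ?_, fun x => ⟨s x, hs x, fun u => ?_⟩⟩
    · obtain ⟨x, rfl⟩ := List.length_eq_one_iff.1 hv
      exact h1 x
    · rw [h1]
      exact h x u

theorem mem_L₂_iff {g : AutT m} :
    g ∈ L₂ m ↔ ∃ s : Fin m → AutT m, (∀ x, HasExp m (s x) 0 0) ∧
      ∀ x u, g (x :: u) = x :: s x u := by
  rw [L₂, mem_psiInv_iff fun h hh => (mem_H'_iff.1 hh).apply_nil]
  simp only [mem_H'_iff]

/-- An element of `H'` with prescribed sections on the first level. -/
theorem exists_mem_H'_of_sections (t : Fin m → ℤ) (h : Fin m → AutT m)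
    (H : ∀ x, HasExp m (h x) (t x) (t x)) (ht : ∑ x, t x = 0) :
    ∃ g ∈ H' m, ∀ x u, g (x :: u) = x :: h x u := by
  obtain ⟨g, g1, g2⟩ := exists_hasExp_of_sections 0 t h (by simpa using H)
  exact ⟨g, mem_H'_iff.2 (g1.cast (by simp [ht]) (by simp [ht])), g2⟩

theorem L₂_le_H' : L₂ m ≤ H' m := by
  intro g hg
  obtain ⟨s, hs, h⟩ := mem_L₂_iff.1 hg
  obtain ⟨f, hf, hf'⟩ := exists_mem_H'_of_sections 0 s hs (by simp)
  have : f⁻¹ * g = 1 := eq_one_of_forall_cons fun x u => by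
    rw [RelIso.mul_apply, h, ← hf', RelIso.inv_apply_self]
  rwa [← inv_mul_eq_one.1 this]

theorem sup_le_H' (n : ℕ) : L₂ m ⊔ StH' m n ≤ H' m := sup_le L₂_le_H' inf_le_right

/-! ### The quotient of `H'` and its order -/

/-- The exponents of the sections, as a homomorphism on the commutator subgroup. -/
theorem exists_exponents (hm : 2 ≤ m) : ∃ φ : H' m →* Multiplicative (Fin m → ℤ),
    ∀ (g : H' m) (s : Fin m → AutT m) (t : Fin m → ℤ), (∀ x u, g.1 (x :: u) = x :: s x u) →
      (∀ x, HasExp m (s x) (t x) (t x)) → (φ g).toAdd = t := by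
  choose s t h1 h2 h3 using fun g : H' m => exists_sections_of_mem_H' (by omega) g.2
  have key : ∀ (g : H' m) (r : Fin m → AutT m) (v : Fin m → ℤ),
      (∀ x u, g.1 (x :: u) = x :: r x u) → (∀ x, HasExp m (r x) (v x) (v x)) → t g = v := by
    intro g r v hr hv
    funext x
    have : s g x = r x := RelIso.ext fun u => (List.cons.inj ((h1 g x u).symm.trans (hr x u))).2
    exact ((this ▸ h2 g x).unique hm (hv x)).1
  refine ⟨MonoidHom.mk' (fun g => Multiplicative.ofAdd (t g)) fun f g => ?_, key⟩
  rw [← ofAdd_add]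
  congr 1
  refine key _ (fun x => s f x * s g x) _ (fun x u => ?_) fun x => (h2 f x).mul (h2 g x)
  rw [Subgroup.coe_mul, RelIso.mul_apply, h1, h1]
  rfl

theorem mem_sup_iff (hm : 0 < m) {n d : ℕ} (hd : ∀ t : ℤ, StExp m n t t ↔ (d : ℤ) ∣ t)
    {g : AutT m} :
    g ∈ L₂ m ⊔ StH' m (n + 1) ↔ ∃ (s : Fin m → AutT m) (t : Fin m → ℤ),
      (∀ x u, g (x :: u) = x :: s x u) ∧ (∀ x, HasExp m (s x) (t x) (t x)) ∧
      ∑ x, t x = 0 ∧ ∀ x, (d : ℤ) ∣ t x := by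
  constructor
  · let K : Subgroup (AutT m) :=
      { carrier := {g | ∃ (s : Fin m → AutT m) (t : Fin m → ℤ),
          (∀ x u, g (x :: u) = x :: s x u) ∧ (∀ x, HasExp m (s x) (t x) (t x)) ∧
          ∑ x, t x = 0 ∧ ∀ x, (d : ℤ) ∣ t x}
        one_mem' := ⟨1, 0, fun _ _ => rfl, fun _ => HasExp.one, by simp, by simp⟩
        mul_mem' := by
          rintro f g ⟨s, t, h1, h2, h3, h4⟩ ⟨r, v, k1, k2, k3, k4⟩
          refine ⟨s * r, t + v, fun x u => ?_, fun x => (h2 x).mul (k2 x), ?_,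
            fun x => dvd_add (h4 x) (k4 x)⟩
          · rw [RelIso.mul_apply, k1, h1]
            rfl
          · simp [Finset.sum_add_distrib, h3, k3]
        inv_mem' := by
          rintro g ⟨s, t, h1, h2, h3, h4⟩
          refine ⟨s⁻¹, -t, fun x u => ?_, fun x => (h2 x).inv, by simp [h3],
            fun x => (h4 x).neg_right⟩
          have e := h1 x ((s x)⁻¹ u)
          rw [RelIso.apply_inv_self] at e
          rw [← e, RelIso.inv_apply_self]
          rfl }
    refine fun hg => (sup_le (fun f hf => ?_) fun f hf => ?_ : L₂ m ⊔ StH' m (n + 1) ≤ K) hg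
    · obtain ⟨s, hs, h⟩ := mem_L₂_iff.1 hf
      exact ⟨s, 0, h, hs, by simp, by simp⟩
    · obtain ⟨s, δ, t, h1, h2, h3, h4, h5⟩ :=
        (mem_H'_iff.1 hf.2).sections_of_mem_St hm hf.1
      obtain rfl : δ = 0 := by
        have := h2.symm
        simp only [add_zero, mul_eq_zero, Nat.cast_eq_zero] at this
        omega
      simp only [zero_add] at h4
      exact ⟨s, t, h1, h4, by simpa using h5,
        fun x => (hd _).1 ((stExp_iff hm _ _ _).2 ⟨s x, h3 x, h4 x⟩)⟩
  · rintro ⟨s, t, h1, h2, h3, h4⟩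
    choose k hS hE using fun x => (stExp_iff hm _ _ _).1 ((hd _).2 (h4 x))
    obtain ⟨f, hf, hf'⟩ := exists_mem_H'_of_sections t k hE h3
    -- `f` lies in `StH'` and its sections have the same exponents as those of `g`, so `g * f⁻¹`
    -- lies in `L₂`.
    have : g = g * f⁻¹ * f := by group
    rw [this]
    refine Subgroup.mul_mem_sup (mem_L₂_iff.2 ⟨fun x => s x * (k x)⁻¹, fun x => ?_,
      fun x u => ?_⟩) ⟨fun v hv => ?_, hf⟩
    · exact ((h2 x).mul (hE x).inv).cast (by ring) (by ring)
    · have e := hf' x ((k x)⁻¹ u)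
      rw [RelIso.apply_inv_self] at e
      rw [RelIso.mul_apply, ← e, RelIso.inv_apply_self, h1]
      rfl
    · obtain _ | ⟨x, u⟩ := v
      · simp at hv
      · rw [hf', hS x u (by simpa using hv)]

theorem relIndex_sup (hm : 2 ≤ m) {n d : ℕ} (hd0 : d ≠ 0)
    (hd : ∀ t : ℤ, StExp m n t t ↔ (d : ℤ) ∣ t) :
    (L₂ m ⊔ StH' m (n + 1)).relIndex (H' m) = d ^ (m - 1) := by
  obtain ⟨φ, hφ⟩ := exists_exponents hm
  obtain ⟨m, rfl⟩ : ∃ j, m = j + 1 := ⟨m - 1, by omega⟩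
  -- Coordinate `0` is dropped: it is minus the sum of the others.
  let ρ : (Fin (m + 1) → ℤ) →+ (Fin m → ZMod d) :=
    AddMonoidHom.mk' (fun t x => (t x.succ : ZMod d)) fun _ _ => by ext; simp
  let Φ : H' (m + 1) →* Multiplicative (Fin m → ZMod d) := ρ.toMultiplicative.comp φ
  have hker : (L₂ (m + 1) ⊔ StH' (m + 1) (n + 1)).subgroupOf (H' (m + 1)) = Φ.ker := by
    ext g
    obtain ⟨s, t, h1, h2, h3⟩ := exists_sections_of_mem_H' (by omega) g.2
    have hΦ : Φ g = 1 ↔ ∀ x : Fin m, (d : ℤ) ∣ t x.succ := by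
      have e : (Φ g).toAdd = fun x => (t x.succ : ZMod d) := by
        rw [← hφ g s t h1 h2]
        rfl
      rw [← Multiplicative.toAdd.injective.eq_iff, e, toAdd_one, funext_iff]
      simp only [Pi.zero_apply, ZMod.intCast_zmod_eq_zero_iff_dvd]
    rw [Subgroup.mem_subgroupOf, mem_sup_iff (by omega) hd, MonoidHom.mem_ker, hΦ]
    constructor
    · rintro ⟨r, v, k1, k2, -, k4⟩ x
      rw [← hφ g s t h1 h2, hφ g r v k1 k2]
      exact k4 _
    · intro h
      refine ⟨s, t, h1, h2, h3, Fin.cases ?_ h⟩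
      rw [Fin.sum_univ_succ] at h3
      rw [eq_neg_of_add_eq_zero_left h3]
      exact (Finset.dvd_sum fun x _ => h x).neg_right
  have hsurj : Function.Surjective Φ := by
    intro v
    obtain ⟨w, hw⟩ : ∃ w : Fin m → ℤ, ∀ x, ((w x : ℤ) : ZMod d) = v.toAdd x :=
      ⟨fun x => (v.toAdd x).cast, fun x => ZMod.intCast_zmod_cast _⟩
    let t : Fin (m + 1) → ℤ := Fin.cons (-∑ x, w x) w
    -- Powers of `b * a` realize all diagonal exponents, so every sum-zero vector `t` arises from
    -- `H'`.
    have hE : ∀ i : ℤ, HasExp (m + 1) ((b (m + 1) * a (m + 1)) ^ i) i i := fun i =>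
      ((HasExp.gen_b.mul HasExp.gen_a).zpow i).cast (by ring) (by ring)
    obtain ⟨g, hg, hg'⟩ := exists_mem_H'_of_sections t _ (fun x => hE (t x))
      (by simp [t, Fin.sum_univ_succ])
    refine ⟨⟨g, hg⟩, ?_⟩
    apply Multiplicative.toAdd.injective
    funext x
    rw [← hw]
    have := hφ ⟨g, hg⟩ _ t hg' fun x => hE (t x)
    change (((φ ⟨g, hg⟩).toAdd x.succ : ℤ) : ZMod d) = _
    rw [this]
    simp [t]
  have : NeZero d := ⟨hd0⟩
  rw [Subgroup.relIndex, hker, Subgroup.index_ker, MonoidHom.range_eq_top.2 hsurj,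
    Subgroup.card_top, Nat.card_congr Multiplicative.toAdd, Nat.card_fun, Nat.card_zmod]
  simp

end BSV

theorem mainTheorem4 (m : ℕ) (hm : 2 ≤ m) (n : ℕ) (hn : 2 ≤ n) :
    BSV.L₂ m ⊔ BSV.StH' m n ≤ BSV.H' m ∧
    (BSV.L₂ m ⊔ BSV.StH' m n).relIndex (BSV.H' m) ≠ 0 ∧
    Real.logb (m : ℝ) ((BSV.L₂ m ⊔ BSV.StH' m n).relIndex (BSV.H' m) : ℝ) =
      ((m : ℝ) - 1) *
        ((BSV.k n : ℝ) - (BSV.e (n - 1) : ℝ) * (BSV.τ m : ℝ) * Real.logb (m : ℝ) 2) := by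
  obtain ⟨d, hd, hd'⟩ := BSV.stExp_diag_iff (m := m) (by omega) hn
  have hd0 : d ≠ 0 := by
    rintro rfl
    rw [zero_mul] at hd
    exact pow_ne_zero _ (by omega) hd.symm
  have hidx := BSV.relIndex_sup hm hd0 hd'
  rw [Nat.sub_add_cancel (by omega)] at hidx
  refine ⟨BSV.sup_le_H' n, ?_, ?_⟩
  · rw [hidx]
    exact pow_ne_zero _ hd0
  · have hlog : Real.logb m d + (BSV.e (n - 1) * BSV.τ m) * Real.logb m 2 = BSV.k n := by
      have h := congrArg (fun i : ℕ => Real.logb (m : ℝ) (i : ℝ)) hd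
      simp only [Nat.cast_mul, Nat.cast_pow, Nat.cast_ofNat] at h
      rw [Real.logb_mul (by exact_mod_cast hd0) (by positivity), Real.logb_pow, Real.logb_pow,
        Real.logb_self_eq_one (by exact_mod_cast hm), mul_one] at h
      exact_mod_cast h
    rw [hidx, Nat.cast_pow, Real.logb_pow, Nat.cast_sub (by omega), Nat.cast_one, ← hlog]
    ring
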